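/- Conventions. $\mathcal A\subseteq M_n(\mathbb C)$ and $\mathcal B\subseteq M_m(\mathbb C)$ denote unital $*$-subalgebras, with the matrix trace $\mathrm{Tr}$ and the Hilbert--Schmidt inner product $\langle a,b\rangle=\mathrm{Tr}\,a^*b$; density operators are positive elements of trace $1$. A linear map $\Phi$ is a unital Schwarz map if $\Phi(I)=I$ and $\Phi(a^*a)\ge\Phi(a)^*\Phi(a)$ for all $a$. For linear $T:\mathcal A\to\mathcal B$, $T^*$ is the Hilbert--Schmidt adjoint and $T_\rho(b)=T(\rho)^{-1/2}T(\rho^{1/2}b\rho^{1/2})T(\rho)^{-1/2}$. $T$ is reversible for a set $\mathcal S$ of density operators if there is a linear $S:\mathcal B\to\mathcal A$ with $S^*$ a unital Schwarz map and $S(T(\tau))=\tau$ for all $\tau\in\mathcal S$. For $f:[0,\infty)\to\mathbb R$ and $\mathrm{supp}\,\sigma\le\mathrm{supp}\,\rho$ the $f$-divergence is $S_f(\sigma,\rho)=\langle\rho^{1/2},f(\Delta_{\sigma,\rho})\rho^{1/2}\rangle$, where $\Delta_{\sigma,\rho}(a)=\sigma a\rho^{-1}$ on $\mathcal A$; $L_\sigma$,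 $R_\rho$ are left and right multiplication. The setting (C) for $(T,\mathcal S,\rho)$ is: $\mathcal S$ is a set of density operators, $\rho\in\mathcal S$ is invertible, $T(\rho)$ is invertible, and both $T^*$ and $T_\rho$ are unital Schwarz maps. Let $f(x)=(1+x)^{-1}$, $x\ge0$. (1) $f$ is operator convex, and strictly so: for positive matrices $a,b$ and $0<t<1$, $f(ta+(1-t)b)=tf(a)+(1-t)f(b)$ only if $a=b$. The Dirac measure $\mu=\delta_1$ is the one and only nonnegative measure $\mu$ on $(0,\infty)$ with $\int(1+t)^{-2}d\mu(t)<\infty$ for which there are $a\in\mathbb R$, $b\ge0$ such that $f(x)=f(0)+ax+bx^2+\int_{(0,\infty)}\bigl(\frac{x}{1+t}-\frac{x}{x+t}\bigr)d\mu(t)$ for all $x\ge 0$. (2) For density operators $\sigma,\rho\in\mathcal A$ with $\rho$ invertible, $L_\sigma+R_\rho$ is invertible on $\mathcal A$ and $S_f(\sigma,\rho)=\mathrm{Tr}\,\rho\,(L_\sigma+R_\rho)^{-1}(\rho)$. (3) Let $\sigma\in\mathcal A$ be an invertible density operator and $p\in\mathcal A$ a projection with $\sigma p\ne p\sigma$ and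 $\lambda:=\mathrm{Tr}\,p\sigma\ne\frac12$. Let $\mathcal B\subseteq\mathcal A$ be the subalgebra generated by $p$ (and $I$). Then $\mathcal B$ is abelian, and there is exactly one trace preserving conditional expectation $T:\mathcal A\to\mathcal B$ (positive linear map with $T(bac)=bT(a)c$ for $a\in\mathcal A$, $b,c\in\mathcal B$, and $\mathrm{Tr}\,T(a)=\mathrm{Tr}\,a$); $T(\sigma)$ is the density of the restriction of $\sigma$ to $\mathcal B$, i.e. $\mathrm{Tr}\,T(\sigma)b=\mathrm{Tr}\,\sigma b$ for $b\in\mathcal B$. Put $x:=(1-\lambda)p+\lambda(I-p)\in\mathcal B$ and $\rho:=(I-x)^{-1}\sigma x$. Then $0<\lambda<1$, $I-x$ is invertible, $\rho=\frac1{\lambda(1-\lambda)}x\sigma x$, $\rho$ is an invertible density operator, $T(\rho)=(I-x)^{-1}T(\sigma)x$, and (C) holds for $T$, $\mathcal S=\{\sigma,\rho\}$ and $\rho$. Moreover $L_{T(\sigma)}+R_{T(\rho)}$ is invertible on $\mathcal B$, $$(L_\sigma+R_\rho)^{-1}(\rho)=x=(L_{T(\sigma)}+R_{T(\rho)})^{-1}(T(\rho)),\qquad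 S_f(T(\sigma),T(\rho))=S_f(\sigma,\rho),$$ but $T$ is not reversible for $\{\sigma,\rho\}$. (4) For every $n\ge2$ there are $\sigma,p\in\mathcal A=M_n(\mathbb C)$ as in (3). (5) Consequently, in the setting (C), the equality $S_f(T(\tau),T(\rho))=S_f(\tau,\rho)$ for all $\tau\in\mathcal S$ does not in general imply that $T$ is reversible for $\mathcal S$, although $f$ is strictly operator convex. Hence, in the criterion that $T$ is reversible for $\mathcal S$ whenever such an equality holds for an operator convex function whose representing measure has sufficiently many support points, the support condition cannot be removed. -/

import Mathlib

open MeasureTheory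
open scoped ComplexOrder

noncomputable section

namespace QRev

abbrev Mat (n : ℕ) : Type := Matrix (Fin n) (Fin n) ℂ

/-- The (unital) C*-subalgebras of `B(ℂⁿ)`. -/
abbrev Alg (n : ℕ) : Type := StarSubalgebra ℂ (Mat n)

/-! ### Operator convexity and integral representations -/

/-- `f : [0,∞) → ℝ` is operator convex: the convexity inequality holds in the Loewner order for
positive semidefinite complex matrices of every size (values of `f` at negative reals are
irrelevant). -/
def OperatorConvex (f : ℝ → ℝ) : Prop :=
  ∀ (k : ℕ) (a b : Mat k), a.PosSemidef → b.PosSemidef → ∀ t : ℝ, 0 ≤ t → t ≤ 1 →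
    (t • cfc f a + (1 - t) • cfc f b - cfc f (t • a + (1 - t) • b)).PosSemidef

/-- Operator convex, with equality in the convexity inequality only in the trivial cases. -/
def StrictlyOperatorConvex (f : ℝ → ℝ) : Prop :=
  OperatorConvex f ∧
    ∀ (k : ℕ) (a b : Mat k), a.PosSemidef → b.PosSemidef → ∀ t : ℝ, 0 < t → t < 1 →
      cfc f (t • a + (1 - t) • b) = t • cfc f a + (1 - t) • cfc f b → a = b

/-- `μ` is a nonnegative measure on `(0,∞)` with `∫ (1+t)⁻² dμ < ∞` and
`f x = f 0 + a x + b x² + ∫ (x/(1+t) - x/(x+t)) dμ(t)` on `[0,∞)`, for some real `a` and some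
`b ≥ 0`. -/
structure IsRepresentingMeasure (f : ℝ → ℝ) (μ : Measure ℝ) : Prop where
  null : μ (Set.Iic 0) = 0
  finite : ∫⁻ t in Set.Ioi 0, ENNReal.ofReal (((1 + t) ^ 2)⁻¹) ∂μ < ⊤
  repr : ∃ a b : ℝ, 0 ≤ b ∧ ∀ x : ℝ, 0 ≤ x →
    f x = f 0 + a * x + b * x ^ 2 + ∫ t in Set.Ioi 0, (x / (1 + t) - x / (x + t)) ∂μ

variable {n m : ℕ}

/-! ### States, powers -/

/-- Density operators in `A` (with respect to the trace of `Mₙ(ℂ)`). -/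
structure IsDensity {A : Alg n} (a : A) : Prop where
  pos : (a : Mat n).PosSemidef
  trace_eq : (a : Mat n).trace = 1

theorem cfc_mem_alg (A : Alg n) (f : ℝ → ℝ) (a : A) : cfc f (a : Mat n) ∈ A := by
  have hc : IsClosed (A : Set (Mat n)) :=
    (Subalgebra.toSubmodule A.toSubalgebra).closed_of_finiteDimensional
  exact cfc_mem (hs := hc) f a.2

/-- The real power `a ^ s` of a positive element `a` of `A` (for `s < 0` the generalized inverse
power, since `(0 : ℝ) ^ s = 0` for `s ≠ 0`). -/
def pow {A : Alg n} (a : A) (s : ℝ) : A :=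
  ⟨cfc (fun x : ℝ => x ^ s) (a : Mat n), cfc_mem_alg A _ a⟩

/-! ### The Hilbert--Schmidt space of an algebra -/

/-- `A` as a Hilbert space, with the Hilbert--Schmidt inner product `⟨a, b⟩ = Tr a* b`. -/
def HS (A : Alg n) : Type := A

instance (A : Alg n) : AddCommGroup (HS A) := inferInstanceAs (AddCommGroup A)

instance (A : Alg n) : Module ℂ (HS A) := inferInstanceAs (Module ℂ A)

/-- The identity map from `A` to its Hilbert space. -/
def toHS {A : Alg n} : A ≃ₗ[ℂ] HS A := LinearEquiv.refl ℂ A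

/-- The underlying matrix. -/
def HS.mat {A : Alg n} (a : HS A) : Mat n := (toHS.symm a : Mat n)

instance hsCore (A : Alg n) : InnerProductSpace.Core ℂ (HS A) where
  inner a b := (star a.mat * b.mat).trace
  conj_inner_symm a b := by
    rw [starRingEnd_apply, Matrix.star_eq_conjTranspose, Matrix.star_eq_conjTranspose,
      ← Matrix.trace_conjTranspose]
    simp
  re_inner_nonneg a := by
    have h := (Matrix.posSemidef_conjTranspose_mul_self a.mat).trace_nonneg
    exact (Complex.le_def.1 h).1
  add_left a b c := by
    change (star (a.mat + b.mat) * c.mat).trace = _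
    simp [star_add, add_mul, Matrix.trace_add]
  smul_left a b r := by
    change (star (r • a.mat) * b.mat).trace = _
    simp [star_smul, Matrix.trace_smul]
  definite a h := by
    have h' : a.mat = 0 := Matrix.trace_conjTranspose_mul_self_eq_zero_iff.1 h
    exact Subtype.ext h'

instance (A : Alg n) : NormedAddCommGroup (HS A) :=
  InnerProductSpace.Core.toNormedAddCommGroup (𝕜 := ℂ)

instance (A : Alg n) : InnerProductSpace ℂ (HS A) :=
  InnerProductSpace.ofCore (hsCore A).toCore

instance (A : Alg n) : FiniteDimensional ℂ (HS A) :=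
  inferInstanceAs (FiniteDimensional ℂ (Subalgebra.toSubmodule A.toSubalgebra))

instance (A : Alg n) : CompleteSpace (HS A) := FiniteDimensional.complete ℂ (HS A)

theorem HS.inner_eq {A : Alg n} (a b : HS A) :
    inner ℂ a b = (star a.mat * b.mat).trace := rfl

/-- The Hilbert--Schmidt adjoint `T* : B → A` of a linear map `T : A → B`. -/
def hsAdjoint {A : Alg n} {B : Alg m} (T : A →ₗ[ℂ] B) : B →ₗ[ℂ] A :=
  toHS.symm.toLinearMap ∘ₗ
    LinearMap.adjoint (toHS.toLinearMap ∘ₗ T ∘ₗ toHS.symm.toLinearMap : HS A →ₗ[ℂ] HS B) ∘ₗ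
    toHS.toLinearMap

theorem hsAdjoint_spec {A : Alg n} {B : Alg m} (T : A →ₗ[ℂ] B) (a : A) (b : B) :
    (star (T a : Mat m) * (b : Mat m)).trace = (star (a : Mat n) * (hsAdjoint T b : Mat n)).trace :=
  (LinearMap.adjoint_inner_right
    (toHS.toLinearMap ∘ₗ T ∘ₗ toHS.symm.toLinearMap : HS A →ₗ[ℂ] HS B) (toHS a) (toHS b)).symm

/-! ### `f`-divergences -/

/-- The relative modular operator `Δ_{σ,ρ} : a ↦ σ a ρ⁻¹` on the Hilbert space `A`. -/
def relModular {A : Alg n} (σ ρ : A) : HS A →L[ℂ] HS A :=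
  LinearMap.toContinuousLinearMap (toHS.conj (LinearMap.mulLeftRight ℂ (σ, pow ρ (-1))))

/-- The `f`-divergence `S_f(σ, ρ) = ⟨ρ^{1/2}, f(Δ_{σ,ρ}) ρ^{1/2}⟩`, for density operators with
`supp σ ≤ supp ρ`; here `f(Δ_{σ,ρ})` is the functional calculus of the positive operator
`Δ_{σ,ρ}` on the Hilbert space `A`. -/
def fDivergence (f : ℝ → ℝ) {A : Alg n} (σ ρ : A) : ℝ :=
  (inner ℂ (toHS (pow ρ (1 / 2))) (cfc f (relModular σ ρ) (toHS (pow ρ (1 / 2))))).re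

/-- The operator `L_σ + R_ρ : a ↦ σ a + a ρ` on `A`. -/
def leftAddRight {A : Alg n} (σ ρ : A) : Module.End ℂ A :=
  LinearMap.mulLeft ℂ σ + LinearMap.mulRight ℂ ρ

/-! ### Schwarz maps, the dual map, reversibility -/

/-- Unital maps with `Φ(a* a) ≥ Φ(a)* Φ(a)`. -/
structure IsUnitalSchwarz {A : Alg n} {B : Alg m} (Φ : A →ₗ[ℂ] B) : Prop where
  unital : Φ 1 = 1
  schwarz : ∀ a : A, ((Φ (star a * a) - star (Φ a) * Φ a : B) : Mat m).PosSemidef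

/-- `T_ρ(b) = T(ρ)^{-1/2} T(ρ^{1/2} b ρ^{1/2}) T(ρ)^{-1/2}`. -/
def dualMap {A : Alg n} {B : Alg m} (T : A →ₗ[ℂ] B) (ρ : A) : A →ₗ[ℂ] B :=
  LinearMap.mulLeftRight ℂ (pow (T ρ) (-(1 / 2)), pow (T ρ) (-(1 / 2))) ∘ₗ T ∘ₗ
    LinearMap.mulLeftRight ℂ (pow ρ (1 / 2), pow ρ (1 / 2))

/-- `T` is reversible for `𝒮`: there is `S : B → A` with `S*` a unital Schwarz map and
`S (T τ) = τ` for all `τ ∈ 𝒮`. -/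
def Reversible {A : Alg n} {B : Alg m} (T : A →ₗ[ℂ] B) (𝒮 : Set A) : Prop :=
  ∃ S : B →ₗ[ℂ] A, IsUnitalSchwarz (hsAdjoint S) ∧ ∀ τ ∈ 𝒮, S (T τ) = τ

/-- The setting of the reversibility criteria: `𝒮` is a set of density operators containing the
invertible element `ρ`, `T ρ` is invertible, and both `T*` and `T_ρ` are unital Schwarz maps. -/
structure ReversibilitySetting {A : Alg n} {B : Alg m} (T : A →ₗ[ℂ] B) (𝒮 : Set A) (ρ : A) :
    Prop where
  density : ∀ τ ∈ 𝒮, IsDensity τ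
  mem : ρ ∈ 𝒮
  isUnit : IsUnit ρ
  isUnit_map : IsUnit (T ρ)
  adjoint_schwarz : IsUnitalSchwarz (hsAdjoint T)
  dual_schwarz : IsUnitalSchwarz (dualMap T ρ)

/-! ### The conditional expectation onto the algebra generated by a projection -/

/-- Trace preserving conditional expectations of `A` onto a subalgebra `B ⊆ A`: positive,
`E (b a c) = b E(a) c` for `a ∈ A` and `b, c ∈ B`, and `Tr E(a) = Tr a`. -/
structure IsTracePreservingCondExp {A B : Alg n} (h : B ≤ A) (E : A →ₗ[ℂ] B) : Prop where
  pos : ∀ a : A, (a : Mat n).PosSemidef → (E a : Mat n).PosSemidef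
  bimodule : ∀ (a : A) (b c : B),
    E (StarSubalgebra.inclusion h b * a * StarSubalgebra.inclusion h c) = b * E a * c
  trace_eq : ∀ a : A, (E a : Mat n).trace = (a : Mat n).trace

/-- The subalgebra generated by (the identity and) `p`. -/
def genBy {A : Alg n} (p : A) : Alg n := StarAlgebra.adjoin ℂ {(p : Mat n)}

theorem genBy_le {A : Alg n} (p : A) : genBy p ≤ A :=
  StarAlgebra.adjoin_le (by simp)

/-- `p` as an element of the subalgebra that it generates. -/
def genBy.gen {A : Alg n} (p : A) : genBy p :=
  ⟨p, StarAlgebra.subset_adjoin ℂ _ (Set.mem_singleton _)⟩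

/-- `(1 - l) p + l (1 - p)`. -/
def exX {A : Alg n} (p : A) (l : ℝ) : A := (1 - l : ℂ) • p + (l : ℂ) • (1 - p)

/-- `ρ = (1 - x)⁻¹ σ x` with `x = (1 - l) p + l (1 - p)`. -/
def exRho {A : Alg n} (σ p : A) (l : ℝ) : A := Ring.inverse (1 - exX p l) * σ * exX p l

/-- The function `(1 + x)⁻¹`. -/
def exF (x : ℝ) : ℝ := (1 + x)⁻¹

end QRev

end

open QRev

/-!
Since `cfc exF Δ = (1 + Δ)⁻¹`, the divergence `S_f(σ, ρ)` is `Tr ρ x` for the solution `x` of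
`σ x + x ρ = ρ`. For `ρ = (1 - x)⁻¹ σ x` this solution is the prescribed `x ∈ B`, and a conditional
expectation `T` onto `B` carries the equation over to `T σ` and `T ρ` with the same `x`, so the
divergence is preserved. On the other hand `ρ` is proportional to `x σ x`, a linear combination of
`σ` and `l (p σ + σ p) + (1 - 2 l) p σ p`. A map recovering `σ` and `ρ` from `T σ` and `T ρ` is
positive and, as `l ≠ 1 / 2`, also recovers this last element from its analogue for `T σ`, which is
positive because `B` is commutative. So the element itself is positive, which forces `σ p = p σ`.

Strict convexity of `(1 + x)⁻¹` comes from an exact formula for the convexity defect of the inverse,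
and uniqueness of the representing measure from a divided difference whose kernel is nonnegative on
`(0, ∞)` and vanishes only at `1`.
-/

namespace QRev

theorem integrableOn_stieltjes_kernel {μ : Measure ℝ}
    (hμ : ∫⁻ t in Set.Ioi 0, ENNReal.ofReal (((1 + t) ^ 2)⁻¹) ∂μ < ⊤) {x : ℝ} (hx : 0 < x) :
    IntegrableOn (fun t : ℝ => ((1 + t) * (x + t))⁻¹) (Set.Ioi 0) μ := by
  have hsq : IntegrableOn (fun t : ℝ => ((1 + t) ^ 2)⁻¹) (Set.Ioi 0) μ := by
    refine ⟨by fun_prop, ?_⟩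
    rwa [hasFiniteIntegral_iff_ofReal (Filter.Eventually.of_forall fun t => by positivity)]
  refine Integrable.mono' (hsq.const_mul (min 1 x)⁻¹) (by fun_prop) ?_
  filter_upwards [ae_restrict_mem measurableSet_Ioi] with t (ht : 0 < t)
  have hmin : min 1 x * (1 + t) ≤ x + t := by
    nlinarith [min_le_left 1 x, min_le_right 1 x]
  have : 0 < min 1 x := lt_min one_pos hx
  rw [Real.norm_of_nonneg (by positivity), ← mul_inv]
  refine inv_anti₀ (by positivity) ?_
  calc min 1 x * (1 + t) ^ 2 = (1 + t) * (min 1 x * (1 + t)) := by ring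
    _ ≤ (1 + t) * (x + t) := by gcongr

theorem IsRepresentingMeasure.exists_eq_add_integral {f : ℝ → ℝ} {μ : Measure ℝ}
    (h : IsRepresentingMeasure f μ) : ∃ a b : ℝ, 0 ≤ b ∧ ∀ x : ℝ, 0 < x →
      f x = f 0 + a * x + b * x ^ 2 +
        x * (x - 1) * ∫ t in Set.Ioi 0, ((1 + t) * (x + t))⁻¹ ∂μ := by
  obtain ⟨a, b, hb, hrepr⟩ := h.repr
  refine ⟨a, b, hb, fun x hx => ?_⟩
  rw [hrepr x hx.le, ← integral_const_mul]
  congr 1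
  refine setIntegral_congr_fun measurableSet_Ioi fun t (ht : 0 < t) => ?_
  field_simp
  ring

-- Multiplied by `(1 + x)² / x`, both `f x - f 0` and the linear term become polynomials of degree
-- at most two. The third divided difference at `1, 2, 3, 4` kills these, is `b` on `b x²`, and is
-- the nonnegative function below on the kernel.
theorem IsRepresentingMeasure.integral_dividedDifference_nonpos {μ : Measure ℝ}
    (h : IsRepresentingMeasure exF μ) :
    IntegrableOn (fun t : ℝ => (t - 1) ^ 2 / ((1 + t) * (2 + t) * (3 + t) * (4 + t)))
        (Set.Ioi 0) μ ∧
      ∫ t in Set.Ioi 0, (t - 1) ^ 2 / ((1 + t) * (2 + t) * (3 + t) * (4 + t)) ∂μ ≤ 0 := by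
  obtain ⟨a, b, hb, hrepr⟩ := h.exists_eq_add_integral
  have int_two := (integrableOn_stieltjes_kernel h.finite two_pos).const_mul (9 / 2)
  have int_three := (integrableOn_stieltjes_kernel h.finite three_pos).const_mul 16
  have int_four := (integrableOn_stieltjes_kernel h.finite four_pos).const_mul (25 / 2)
  have hkernel : Set.EqOn (fun t : ℝ => 9 / 2 * ((1 + t) * (2 + t))⁻¹ -
      16 * ((1 + t) * (3 + t))⁻¹ + 25 / 2 * ((1 + t) * (4 + t))⁻¹)
      (fun t => (t - 1) ^ 2 / ((1 + t) * (2 + t) * (3 + t) * (4 + t))) (Set.Ioi 0) := by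
    intro t (ht : 0 < t)
    field_simp
    ring
  refine ⟨IntegrableOn.congr_fun ((int_two.sub int_three).add int_four) hkernel
    measurableSet_Ioi, ?_⟩
  have h1 := hrepr 1 one_pos
  have h2 := hrepr 2 two_pos
  have h3 := hrepr 3 three_pos
  have h4 := hrepr 4 four_pos
  norm_num only [exF] at h1 h2 h3 h4
  have hsplit := integral_add (int_two.sub int_three) int_four
  simp only [Pi.sub_apply, integral_sub int_two int_three, integral_const_mul] at hsplit
  rw [← setIntegral_congr_fun measurableSet_Ioi hkernel, hsplit]
  linarith

theorem IsRepresentingMeasure.ae_eq_one {μ : Measure ℝ} (h : IsRepresentingMeasure exF μ) :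
    ∀ᵐ t ∂μ, t = 1 := by
  obtain ⟨hint, hle⟩ := h.integral_dividedDifference_nonpos
  have hnonneg : 0 ≤ᵐ[μ.restrict (Set.Ioi 0)]
      fun t : ℝ => (t - 1) ^ 2 / ((1 + t) * (2 + t) * (3 + t) * (4 + t)) := by
    filter_upwards [ae_restrict_mem measurableSet_Ioi] with t (ht : 0 < t)
    simp only [Pi.zero_apply]
    positivity
  have hzero := (integral_eq_zero_iff_of_nonneg_ae hnonneg hint).1
    (le_antisymm hle (integral_nonneg_of_ae hnonneg))
  have hpos : ∀ᵐ t ∂μ, t ∈ Set.Ioi (0 : ℝ) := by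
    rw [← Set.compl_Iic]
    exact measure_eq_zero_iff_ae_notMem.1 h.null
  rw [Filter.EventuallyEq, ae_restrict_iff' measurableSet_Ioi] at hzero
  filter_upwards [hzero, hpos] with t ht (ht0 : 0 < t)
  have hden : (1 + t) * (2 + t) * (3 + t) * (4 + t) ≠ 0 := by positivity
  simpa [hden, sub_eq_zero] using ht ht0

theorem IsRepresentingMeasure.eq_dirac {μ : Measure ℝ} (h : IsRepresentingMeasure exF μ) :
    μ = Measure.dirac 1 := by
  obtain ⟨a, b, -, hrepr⟩ := h.exists_eq_add_integral
  have hμ : μ = μ {1} • Measure.dirac 1 := by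
    rw [← Measure.restrict_singleton]
    exact (Measure.restrict_eq_self_of_ae_mem h.ae_eq_one).symm
  have hkernel (x : ℝ) : ∫ t in Set.Ioi 0, ((1 + t) * (x + t))⁻¹ ∂μ =
      (μ {1}).toReal * (2 * (x + 1))⁻¹ := by
    conv_lhs => rw [hμ]
    rw [Measure.restrict_smul, restrict_dirac' measurableSet_Ioi,
      if_pos (Set.mem_Ioi.2 one_pos), integral_smul_measure, integral_dirac, smul_eq_mul]
    norm_num
  have h1 := hrepr 1 one_pos
  have h2 := hrepr 2 two_pos
  have h3 := hrepr 3 three_pos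
  norm_num only [exF, hkernel] at h1 h2 h3
  have hmass : (μ {1}).toReal = 1 := by linarith
  rw [hμ, (ENNReal.toReal_eq_one_iff _).1 hmass, one_smul]

theorem isRepresentingMeasure_exF_dirac : IsRepresentingMeasure exF (Measure.dirac 1) where
  null := by simp
  finite := by
    rw [restrict_dirac' measurableSet_Ioi, if_pos (Set.mem_Ioi.2 one_pos), lintegral_dirac]
    exact ENNReal.ofReal_lt_top
  repr := by
    refine ⟨-1 / 2, 0, le_rfl, fun x hx => ?_⟩
    rw [restrict_dirac' measurableSet_Ioi, if_pos (Set.mem_Ioi.2 one_pos), integral_dirac]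
    simp only [exF]
    field_simp
    ring

theorem isRepresentingMeasure_exF_iff (μ : Measure ℝ) :
    IsRepresentingMeasure exF μ ↔ μ = Measure.dirac 1 :=
  ⟨IsRepresentingMeasure.eq_dirac, fun h => h ▸ isRepresentingMeasure_exF_dirac⟩

open scoped Ring

theorem inverse_convexity_defect {R : Type*} [Ring R] [Algebra ℝ R] {A B : R} {t : ℝ}
    (hA : IsUnit A) (hB : IsUnit B) (hC : IsUnit (t • A + (1 - t) • B)) :
    t • A⁻¹ʳ + (1 - t) • B⁻¹ʳ - (t • A + (1 - t) • B)⁻¹ʳ =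
      t • ((A⁻¹ʳ - (t • A + (1 - t) • B)⁻¹ʳ) * A * (A⁻¹ʳ - (t • A + (1 - t) • B)⁻¹ʳ)) +
      (1 - t) • ((B⁻¹ʳ - (t • A + (1 - t) • B)⁻¹ʳ) * B *
        (B⁻¹ʳ - (t • A + (1 - t) • B)⁻¹ʳ)) := by
  generalize hW : (t • A + (1 - t) • B)⁻¹ʳ = W
  have hWCW : t • (W * A * W) + (1 - t) • (W * B * W) = W := by
    have := congrArg (· * W) (Ring.inverse_mul_cancel _ hC)
    simpa only [hW, mul_add, add_mul, mul_smul_comm, smul_mul_assoc, one_mul] using this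
  have expand {D : R} (hD : IsUnit D) :
      (D⁻¹ʳ - W) * D * (D⁻¹ʳ - W) = D⁻¹ʳ - W - W + W * D * W := by
    rw [sub_mul, Ring.inverse_mul_cancel _ hD, sub_mul, one_mul, mul_sub, mul_assoc W D D⁻¹ʳ,
      Ring.mul_inverse_cancel _ hD, mul_one]
    abel
  rw [expand hA, expand hB]
  calc t • A⁻¹ʳ + (1 - t) • B⁻¹ʳ - W
      = t • (A⁻¹ʳ - W - W) + (1 - t) • (B⁻¹ʳ - W - W) + W := by module
    _ = t • (A⁻¹ʳ - W - W) + (1 - t) • (B⁻¹ʳ - W - W) +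
        (t • (W * A * W) + (1 - t) • (W * B * W)) := by rw [hWCW]
    _ = _ := by module

theorem posDef_convexCombination {ι 𝕜 : Type*} [RCLike 𝕜] {A B : Matrix ι ι 𝕜}
    (hA : A.PosDef) (hB : B.PosDef) {t : ℝ} (ht0 : 0 ≤ t) (ht1 : t ≤ 1) :
    (t • A + (1 - t) • B).PosDef := by
  obtain rfl | ht0 := ht0.eq_or_lt
  · simpa using hB
  · exact (hA.smul ht0).add_posSemidef (hB.posSemidef.smul (sub_nonneg.2 ht1))

theorem posSemidef_star_mul_mul {ι 𝕜 : Type*} [Fintype ι] [RCLike 𝕜] {P : Matrix ι ι 𝕜}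
    (hP : P.PosSemidef) (D : Matrix ι ι 𝕜) : (star D * P * D).PosSemidef :=
  hP.conjTranspose_mul_mul_same D

theorem mul_eq_zero_of_trace_conj_eq_zero {ι 𝕜 : Type*} [Fintype ι] [RCLike 𝕜]
    {P D : Matrix ι ι 𝕜} (hP : P.PosSemidef) (h : (star D * P * D).trace = 0) : P * D = 0 := by
  classical
  open scoped MatrixOrder in
  obtain ⟨X, rfl⟩ := CStarAlgebra.nonneg_iff_eq_star_mul_self.1 hP.nonneg
  have hXD : X * D = 0 := by
    rw [← Matrix.trace_conjTranspose_mul_self_eq_zero_iff, Matrix.conjTranspose_mul, ← h]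
    simp only [Matrix.star_eq_conjTranspose, mul_assoc]
  rw [mul_assoc, hXD, mul_zero]

section Matrix

variable {ι 𝕜 : Type*} [Fintype ι] [DecidableEq ι] [RCLike 𝕜]

theorem inv_convexity_defect {A B : Matrix ι ι 𝕜} (hA : A.PosDef) (hB : B.PosDef) {t : ℝ}
    (ht0 : 0 ≤ t) (ht1 : t ≤ 1) :
    t • A⁻¹ + (1 - t) • B⁻¹ - (t • A + (1 - t) • B)⁻¹ =
      t • (star (A⁻¹ - (t • A + (1 - t) • B)⁻¹) * A * (A⁻¹ - (t • A + (1 - t) • B)⁻¹)) +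
      (1 - t) • (star (B⁻¹ - (t • A + (1 - t) • B)⁻¹) * B *
        (B⁻¹ - (t • A + (1 - t) • B)⁻¹)) := by
  have hC := posDef_convexCombination hA hB ht0 ht1
  rw [star_sub, star_sub, hA.inv.isHermitian.isSelfAdjoint.star_eq,
    hB.inv.isHermitian.isSelfAdjoint.star_eq, hC.inv.isHermitian.isSelfAdjoint.star_eq]
  simp only [Matrix.nonsing_inv_eq_ringInverse]
  exact inverse_convexity_defect hA.isUnit hB.isUnit hC.isUnit

theorem inv_convexity_defect_posSemidef {A B : Matrix ι ι 𝕜} (hA : A.PosDef) (hB : B.PosDef)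
    {t : ℝ} (ht0 : 0 ≤ t) (ht1 : t ≤ 1) :
    (t • A⁻¹ + (1 - t) • B⁻¹ - (t • A + (1 - t) • B)⁻¹).PosSemidef := by
  rw [inv_convexity_defect hA hB ht0 ht1]
  exact ((posSemidef_star_mul_mul hA.posSemidef _).smul ht0).add
    ((posSemidef_star_mul_mul hB.posSemidef _).smul (sub_nonneg.2 ht1))

theorem eq_of_inv_convexity_defect_eq_zero {A B : Matrix ι ι 𝕜} (hA : A.PosDef) (hB : B.PosDef)
    {t : ℝ} (ht0 : 0 < t) (ht1 : t < 1)
    (h : t • A⁻¹ + (1 - t) • B⁻¹ - (t • A + (1 - t) • B)⁻¹ = 0) : A = B := by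
  rw [inv_convexity_defect hA hB ht0.le ht1.le] at h
  replace h := congrArg Matrix.trace h
  rw [Matrix.trace_add, Matrix.trace_smul, Matrix.trace_smul, Matrix.trace_zero,
    add_eq_zero_iff_of_nonneg
      (smul_nonneg ht0.le (posSemidef_star_mul_mul hA.posSemidef _).trace_nonneg)
      (smul_nonneg (sub_pos.2 ht1).le (posSemidef_star_mul_mul hB.posSemidef _).trace_nonneg),
    smul_eq_zero_iff_right ht0.ne', smul_eq_zero_iff_right (sub_pos.2 ht1).ne'] at h
  have hA' := mul_eq_zero_of_trace_conj_eq_zero hA.posSemidef h.1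
  have hB' := mul_eq_zero_of_trace_conj_eq_zero hB.posSemidef h.2
  rw [hA.isUnit.mul_right_eq_zero, sub_eq_zero] at hA'
  rw [hB.isUnit.mul_right_eq_zero, sub_eq_zero] at hB'
  rw [← Matrix.nonsing_inv_nonsing_inv A ((Matrix.isUnit_iff_isUnit_det A).1 hA.isUnit),
    hA', ← hB', Matrix.nonsing_inv_nonsing_inv B ((Matrix.isUnit_iff_isUnit_det B).1 hB.isUnit)]

end Matrix

theorem cfc_exF_eq_inverse {R : Type*} [Ring R] [StarRing R] [TopologicalSpace R] [Algebra ℝ R]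
    [ContinuousFunctionalCalculus ℝ R IsSelfAdjoint] {a : R} (ha : IsSelfAdjoint a)
    (hspec : ∀ x ∈ spectrum ℝ a, 0 ≤ x) : IsUnit (1 + a) ∧ cfc exF a = Ring.inverse (1 + a) := by
  have hne : ∀ x ∈ spectrum ℝ a, 1 + x ≠ 0 := fun x hx => by linarith [hspec x hx]
  have hcfc : cfc (fun x : ℝ => 1 + x) a = 1 + a := by
    rw [cfc_const_add (1 : ℝ) (fun x => x) a, cfc_id' ℝ a, map_one]
  rw [← hcfc]
  exact ⟨(isUnit_cfc_iff _ a).2 hne, cfc_inv _ a hne⟩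

theorem spectrum_nonneg_of_posSemidef {ι 𝕜 : Type*} [Fintype ι] [DecidableEq ι] [RCLike 𝕜]
    {a : Matrix ι ι 𝕜} (ha : a.PosSemidef) {x : ℝ} (hx : x ∈ spectrum ℝ a) : 0 ≤ x := by
  open scoped MatrixOrder in
  exact spectrum_nonneg_of_nonneg ha.nonneg hx

theorem cfc_exF_eq_inv {ι : Type*} [Fintype ι] [DecidableEq ι] {a : Matrix ι ι ℂ}
    (ha : a.PosSemidef) : cfc exF a = (1 + a)⁻¹ := by
  rw [Matrix.nonsing_inv_eq_ringInverse]
  exact (cfc_exF_eq_inverse ha.isHermitian.isSelfAdjoint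
    fun x hx => spectrum_nonneg_of_posSemidef ha hx).2

theorem strictlyOperatorConvex_exF : StrictlyOperatorConvex exF := by
  have one_add_posDef {k : ℕ} {a : Mat k} (ha : a.PosSemidef) : (1 + a).PosDef :=
    Matrix.PosDef.one.add_posSemidef ha
  have defect_eq {k : ℕ} {a b : Mat k} (ha : a.PosSemidef) (hb : b.PosSemidef) {t : ℝ}
      (ht0 : 0 ≤ t) (ht1 : t ≤ 1) :
      t • cfc exF a + (1 - t) • cfc exF b - cfc exF (t • a + (1 - t) • b) =
        t • (1 + a)⁻¹ + (1 - t) • (1 + b)⁻¹ - (t • (1 + a) + (1 - t) • (1 + b))⁻¹ := by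
    rw [cfc_exF_eq_inv ha, cfc_exF_eq_inv hb,
      cfc_exF_eq_inv ((ha.smul ht0).add (hb.smul (sub_nonneg.2 ht1)))]
    congr 2
    module
  refine ⟨fun k a b ha hb t ht0 ht1 => ?_, fun k a b ha hb t ht0 ht1 h => ?_⟩
  · rw [defect_eq ha hb ht0 ht1]
    exact inv_convexity_defect_posSemidef (one_add_posDef ha) (one_add_posDef hb) ht0 ht1
  · rw [eq_comm, ← sub_eq_zero, defect_eq ha hb ht0.le ht1.le] at h
    exact add_left_cancel (eq_of_inv_convexity_defect_eq_zero (one_add_posDef ha)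
      (one_add_posDef hb) ht0 ht1 h)

theorem exists_common_eigenvector {K V : Type*} [Field K] [IsAlgClosed K] [AddCommGroup V]
    [Module K V] [FiniteDimensional K V] {f g : Module.End K V} (hcomm : Commute f g) {z : K}
    (hz : f.HasEigenvalue z) : ∃ (v : V) (w : K), v ≠ 0 ∧ f v = z • v ∧ g v = w • v := by
  have invariant : Set.MapsTo g (f.eigenspace z) (f.eigenspace z) :=
    Module.End.mapsTo_genEigenspace_of_comm hcomm z 1
  have : Nontrivial (f.eigenspace z) := (f.eigenspace z).nontrivial_iff_ne_bot.2 hz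
  obtain ⟨w, hw⟩ := Module.End.exists_eigenvalue (g.restrict invariant)
  obtain ⟨v, hv⟩ := hw.exists_hasEigenvector
  exact ⟨v, w, fun h0 => hv.2 (Subtype.ext h0), Module.End.mem_eigenspace_iff.1 v.2,
    congrArg Subtype.val hv.apply_eq_smul⟩

theorem posSemidef_of_forall_eigenvector {ι : Type*} [Fintype ι] {a b : Matrix ι ι ℂ}
    (ha : a.IsHermitian) (hcomm : Commute a b)
    (h : ∀ (z : ℂ) (v : ι → ℂ), b.mulVec v = z • v → 0 ≤ star v ⬝ᵥ a.mulVec v) :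
    a.PosSemidef := by
  classical
  rw [ha.posSemidef_iff_eigenvalues_nonneg]
  intro i
  have heigen : Module.End.HasEigenvalue (Matrix.toLin' a) (ha.eigenvalues i : ℂ) := by
    refine Module.End.hasEigenvalue_of_hasEigenvector (x := (ha.eigenvectorBasis i).ofLp)
      ⟨Module.End.mem_eigenspace_iff.2 ?_, fun h0 =>
        ha.eigenvectorBasis.orthonormal.ne_zero i (PiLp.ext fun j => congrFun h0 j)⟩
    rw [Matrix.toLin'_apply, ha.mulVec_eigenvectorBasis, Complex.coe_smul]
  have hcomm' : Commute (Matrix.toLin' a) (Matrix.toLin' b) :=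
    hcomm.map (Matrix.toLinAlgEquiv' (R := ℂ) (n := ι))
  obtain ⟨v, z, hv, hav, hbv⟩ := exists_common_eigenvector hcomm' heigen
  rw [Matrix.toLin'_apply] at hav hbv
  have hle := h z v hbv
  have hnorm : 0 < star v ⬝ᵥ v := Matrix.dotProduct_star_self_pos_iff.2 hv
  rw [hav, dotProduct_smul, smul_eq_mul] at hle
  exact Complex.zero_le_real.1 (le_of_mul_le_mul_right (by rwa [zero_mul]) hnorm)

section Algebra

variable {n m : ℕ} {A : Alg n} {B : Alg m}

theorem star_eq_of_posSemidef {a : A} (ha : (a : Mat n).PosSemidef) : star a = a :=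
  Subtype.ext ha.isHermitian

theorem star_pow_eq (a : A) (s : ℝ) : star (pow a s) = pow a s :=
  Subtype.ext (cfc_predicate (fun x : ℝ => x ^ s) (a : Mat n))

theorem posSemidef_pow {a : A} (ha : (a : Mat n).PosSemidef) (s : ℝ) :
    (pow a s : Mat n).PosSemidef := by
  open scoped MatrixOrder in
  exact Matrix.nonneg_iff_posSemidef.1
    (cfc_nonneg fun x hx => Real.rpow_nonneg (spectrum_nonneg_of_posSemidef ha hx) s)

theorem pow_one_eq {a : A} (ha : (a : Mat n).PosSemidef) : pow a 1 = a := by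
  refine Subtype.ext ?_
  simp only [pow, Real.rpow_one]
  exact cfc_id' ℝ (a : Mat n) ha.isHermitian.isSelfAdjoint

theorem pow_zero_eq {a : A} (ha : (a : Mat n).PosSemidef) : pow a 0 = 1 := by
  refine Subtype.ext ?_
  simp only [pow, Real.rpow_zero]
  exact cfc_const_one ℝ (a : Mat n) ha.isHermitian.isSelfAdjoint

theorem pow_half_mul_pow_half {a : A} (ha : (a : Mat n).PosSemidef) :
    pow a (1 / 2) * pow a (1 / 2) = a := by
  have hcont : ContinuousOn (fun x : ℝ => x ^ (1 / 2 : ℝ)) (spectrum ℝ (a : Mat n)) :=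
    (Real.continuous_rpow_const (by norm_num)).continuousOn
  refine Subtype.ext ((cfc_mul _ _ (a : Mat n) hcont hcont).symm.trans ?_)
  rw [cfc_congr (g := fun x => x) fun x hx => ?_, cfc_id' ℝ _ ha.isHermitian.isSelfAdjoint]
  simp only [← Real.sqrt_eq_rpow]
  exact Real.mul_self_sqrt (spectrum_nonneg_of_posSemidef ha hx)

theorem pow_mul_pow {a : A} (ha : (a : Mat n).PosSemidef) (hu : IsUnit a) (s t : ℝ) :
    pow a s * pow a t = pow a (s + t) := by
  have hpos : ∀ x ∈ spectrum ℝ (a : Mat n), 0 < x := fun x hx =>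
    (spectrum_nonneg_of_posSemidef ha hx).lt_of_ne' <| by
      rintro rfl
      exact spectrum.zero_notMem ℝ (hu.map A.subtype) hx
  have hcont (s : ℝ) : ContinuousOn (fun x : ℝ => x ^ s) (spectrum ℝ (a : Mat n)) := fun x hx =>
    (Real.continuousAt_rpow_const x s (Or.inl (hpos x hx).ne')).continuousWithinAt
  refine Subtype.ext ((cfc_mul _ _ (a : Mat n) (hcont s) (hcont t)).symm.trans ?_)
  exact cfc_congr fun x hx => (Real.rpow_add (hpos x hx) s t).symm

theorem pow_neg_half_mul_mul_pow_neg_half {a : A} (ha : (a : Mat n).PosSemidef) (hu : IsUnit a) :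
    pow a (-(1 / 2)) * a * pow a (-(1 / 2)) = 1 := by
  nth_rewrite 2 [← pow_one_eq ha]
  rw [pow_mul_pow ha hu, pow_mul_pow ha hu]
  norm_num [pow_zero_eq ha]

instance (A : Alg n) : FiniteDimensional ℂ A :=
  inferInstanceAs (FiniteDimensional ℂ (Subalgebra.toSubmodule A.toSubalgebra))

/-- The restriction to `A` of the matrix trace. -/
def algTrace (A : Alg n) : A →ₗ[ℂ] ℂ :=
  Matrix.traceLinearMap (Fin n) ℂ ℂ ∘ₗ A.subtype.toLinearMap

theorem algTrace_apply (a : A) : algTrace A a = (a : Mat n).trace := rfl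

theorem inner_toHS (a b : A) : inner ℂ (toHS a) (toHS b) = algTrace A (star a * b) := rfl

theorem algTrace_mul_comm (a b : A) : algTrace A (a * b) = algTrace A (b * a) :=
  Matrix.trace_mul_comm (a : Mat n) b

theorem algTrace_star (a : A) : algTrace A (star a) = star (algTrace A a) :=
  Matrix.trace_conjTranspose (a : Mat n)

theorem eq_of_algTrace_mul_eq {a b : A} (h : ∀ c, algTrace A (c * a) = algTrace A (c * b)) :
    a = b := by
  have hzero : inner ℂ (toHS (a - b)) (toHS (a - b)) = (0 : ℂ) := by
    rw [inner_toHS, mul_sub, map_sub, h, sub_self]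
  exact sub_eq_zero.1 (toHS.map_eq_zero_iff.1 (inner_self_eq_zero.1 hzero))

theorem algTrace_mul_nonneg {a b : A} (ha : (a : Mat n).PosSemidef) (hb : (b : Mat n).PosSemidef) :
    0 ≤ algTrace A (a * b) := by
  rw [← pow_half_mul_pow_half hb, ← mul_assoc, algTrace_mul_comm, ← mul_assoc]
  nth_rewrite 1 [← star_pow_eq b]
  exact (posSemidef_star_mul_mul ha _).trace_nonneg

theorem mul_eq_zero_of_algTrace_conj_eq_zero {a b : A} (ha : (a : Mat n).PosSemidef)
    (h : algTrace A (star b * a * b) = 0) : a * b = 0 :=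
  Subtype.ext (mul_eq_zero_of_trace_conj_eq_zero ha h)

theorem linearMap_ext_star_mul_self {R M : Type*} [Ring R] [StarRing R] [Algebra ℂ R]
    [StarModule ℂ R] [AddCommGroup M] [Module ℂ M] {f g : R →ₗ[ℂ] M}
    (h : ∀ a, f (star a * a) = g (star a * a)) : f = g := by
  have polarization (a : R) : (4 : ℂ) • a = star (1 + a) * (1 + a) - star (1 - a) * (1 - a) +
      Complex.I • (star (a + Complex.I • 1) * (a + Complex.I • 1)) -
      Complex.I • (star (a - Complex.I • 1) * (a - Complex.I • 1)) := by
    simp only [star_add, star_sub, star_smul, star_one, mul_add, add_mul, mul_sub, sub_mul,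
      mul_one, one_mul, smul_mul_assoc, mul_smul_comm, smul_add, smul_sub, smul_smul,
      Complex.star_def, Complex.conj_I, mul_neg, Complex.I_mul_I, neg_neg]
    module
  refine LinearMap.ext fun a => smul_right_injective M (four_ne_zero (α := ℂ)) ?_
  simp only [← map_smul f 4, ← map_smul g 4, polarization, map_add, map_sub, map_smul, h]

theorem posSemidef_star_mul_self (a : A) : ((star a * a : A) : Mat n).PosSemidef :=
  Matrix.posSemidef_conjTranspose_mul_self (a : Mat n)

theorem linearMap_ext_posSemidef {M : Type*} [AddCommGroup M] [Module ℂ M] {f g : A →ₗ[ℂ] M}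
    (h : ∀ a : A, (a : Mat n).PosSemidef → f a = g a) : f = g :=
  linearMap_ext_star_mul_self fun a => h _ (posSemidef_star_mul_self a)

theorem star_eq_of_forall_star_algTrace_mul_eq {b : A}
    (h : ∀ c : A, (c : Mat n).PosSemidef → star (algTrace A (b * c)) = algTrace A (b * c)) :
    star b = b := by
  have hext : algTrace A ∘ₗ LinearMap.mulLeft ℂ (star b) = algTrace A ∘ₗ LinearMap.mulLeft ℂ b :=
    linearMap_ext_posSemidef fun c hc => by
      simp only [LinearMap.comp_apply, LinearMap.mulLeft_apply]
      rw [← h c hc, ← algTrace_star, star_mul, star_eq_of_posSemidef hc, algTrace_mul_comm]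
  refine eq_of_algTrace_mul_eq fun c => ?_
  rw [algTrace_mul_comm, algTrace_mul_comm c]
  exact LinearMap.congr_fun hext c

theorem posSemidef_of_forall_algTrace_mul_nonneg {b : A}
    (h : ∀ c : A, (c : Mat n).PosSemidef → 0 ≤ algTrace A (b * c)) : (b : Mat n).PosSemidef := by
  have hsa : IsSelfAdjoint (b : Mat n) := congrArg Subtype.val <|
    star_eq_of_forall_star_algTrace_mul_eq fun c hc => (h c hc).isSelfAdjoint.star_eq
  let negPart : A := ⟨cfc (fun x : ℝ => max (-x) 0) (b : Mat n), cfc_mem_alg A _ b⟩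
  have negPart_psd : (negPart : Mat n).PosSemidef := by
    open scoped MatrixOrder in
    exact Matrix.nonneg_iff_posSemidef.1 (cfc_nonneg fun x _ => le_max_right _ _)
  have mul_negPart : b * negPart = -(negPart * negPart) := by
    refine Subtype.ext ?_
    change (b : Mat n) * cfc _ (b : Mat n) = -(cfc _ (b : Mat n) * cfc _ (b : Mat n))
    nth_rewrite 1 [← cfc_id' ℝ (b : Mat n)]
    rw [← cfc_mul .., ← cfc_mul .., ← cfc_neg]
    refine cfc_congr fun x _ => ?_
    rcases le_total x 0 with hx | hx <;> simp [hx]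
  have trace_negPart : (star (negPart : Mat n) * (negPart : Mat n)).trace = 0 := by
    refine le_antisymm ?_ (posSemidef_star_mul_self negPart).trace_nonneg
    have hle := h negPart negPart_psd
    rw [mul_negPart, map_neg, Left.nonneg_neg_iff] at hle
    rwa [negPart_psd.isHermitian.isSelfAdjoint.star_eq]
  have negPart_eq_zero : cfc (fun x : ℝ => max (-x) 0) (b : Mat n) = 0 :=
    Matrix.trace_conjTranspose_mul_self_eq_zero_iff.1 trace_negPart
  rw [← cfc_zero ℝ (b : Mat n), cfc_eq_cfc_iff_eqOn] at negPart_eq_zero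
  open scoped MatrixOrder in
  refine Matrix.nonneg_iff_posSemidef.1
    ((StarOrderedRing.nonneg_iff_spectrum_nonneg (R := ℝ) (b : Mat n)).2 fun x hx => ?_)
  exact neg_nonpos.1 (max_eq_right_iff.1 (negPart_eq_zero hx))

/-- Linear maps that send positive semidefinite elements to positive semidefinite elements. -/
def IsPositiveMap (T : A →ₗ[ℂ] B) : Prop :=
  ∀ a : A, (a : Mat n).PosSemidef → (T a : Mat m).PosSemidef

theorem IsPositiveMap.map_star {T : A →ₗ[ℂ] B} (hT : IsPositiveMap T) (a : A) :
    T (star a) = star (T a) := by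
  let starConj : A →ₗ[ℂ] B :=
    { toFun := fun a => star (T (star a))
      map_add' := fun a b => by simp only [star_add, map_add]
      map_smul' := fun c a => by simp only [star_smul, map_smul, star_star, RingHom.id_apply] }
  have hext : starConj = T := linearMap_ext_posSemidef fun a ha => by
    change star (T (star a)) = T a
    rw [star_eq_of_posSemidef ha, star_eq_of_posSemidef (hT a ha)]
  exact star_injective (by rw [star_star]; exact LinearMap.congr_fun hext a)

theorem algTrace_hsAdjoint (T : A →ₗ[ℂ] B) (a : A) (b : B) :
    algTrace A (star a * hsAdjoint T b) = algTrace B (star (T a) * b) :=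
  (hsAdjoint_spec T a b).symm

theorem hsAdjoint_hsAdjoint (T : A →ₗ[ℂ] B) : hsAdjoint (hsAdjoint T) = T := by
  refine LinearMap.ext fun a => eq_of_algTrace_mul_eq fun b => ?_
  calc algTrace B (b * hsAdjoint (hsAdjoint T) a)
      = algTrace A (star (hsAdjoint T (star b)) * a) := by
        rw [← algTrace_hsAdjoint, star_star]
    _ = star (algTrace A (star a * hsAdjoint T (star b))) := by
        rw [← algTrace_star, star_mul, star_star]
    _ = algTrace B (b * T a) := by
        rw [algTrace_hsAdjoint, ← algTrace_star, star_mul, star_star, star_star]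

theorem IsPositiveMap.hsAdjoint {T : A →ₗ[ℂ] B} (hT : IsPositiveMap T) :
    IsPositiveMap (hsAdjoint T) := fun b hb =>
  posSemidef_of_forall_algTrace_mul_nonneg fun c hc => by
    rw [algTrace_mul_comm, ← star_eq_of_posSemidef hc, algTrace_hsAdjoint,
      star_eq_of_posSemidef (hT c hc)]
    exact algTrace_mul_nonneg (hT c hc) hb

theorem IsUnitalSchwarz.isPositiveMap {Φ : A →ₗ[ℂ] B} (hΦ : IsUnitalSchwarz Φ) :
    IsPositiveMap Φ := fun a ha => by
  have h := (hΦ.schwarz (pow a (1 / 2))).add (posSemidef_star_mul_self (Φ (pow a (1 / 2))))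
  rwa [star_pow_eq, pow_half_mul_pow_half ha, ← AddMemClass.coe_add, sub_add_cancel] at h

theorem relModular_toHS (σ ρ a : A) : relModular σ ρ (toHS a) = toHS (σ * a * pow ρ (-1)) := rfl

theorem leftAddRight_apply (σ ρ a : A) : leftAddRight σ ρ a = σ * a + a * ρ := rfl

theorem isPositive_relModular {σ ρ : A} (hσ : (σ : Mat n).PosSemidef)
    (hρ : (ρ : Mat n).PosSemidef) : (relModular σ ρ).IsPositive := by
  rw [ContinuousLinearMap.isPositive_iff_complex]
  intro x
  obtain ⟨a, rfl⟩ := toHS.surjective x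
  have hinner : inner ℂ (relModular σ ρ (toHS a)) (toHS a) =
      algTrace A ((star a * σ * a) * pow ρ (-1)) := by
    rw [relModular_toHS, inner_toHS, star_mul, star_mul, star_pow_eq, star_eq_of_posSemidef hσ,
      mul_assoc, algTrace_mul_comm]
  have hnonneg : 0 ≤ inner ℂ (relModular σ ρ (toHS a)) (toHS a) := by
    rw [hinner]
    exact algTrace_mul_nonneg (posSemidef_star_mul_mul hσ a) (posSemidef_pow hρ _)
  obtain ⟨hre, him⟩ := Complex.nonneg_iff.1 hnonneg
  exact ⟨Complex.ext rfl him, hre⟩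

theorem cfc_exF_relModular {σ ρ : A} (hσ : (σ : Mat n).PosSemidef)
    (hρ : (ρ : Mat n).PosSemidef) :
    IsUnit (1 + relModular σ ρ) ∧
      cfc exF (relModular σ ρ) = Ring.inverse (1 + relModular σ ρ) := by
  have hpos := isPositive_relModular hσ hρ
  exact cfc_exF_eq_inverse hpos.isSelfAdjoint fun x hx =>
    spectrum_nonneg_of_nonneg ((ContinuousLinearMap.nonneg_iff_isPositive _).2 hpos) hx

theorem isUnit_leftAddRight {σ ρ : A} (hσ : (σ : Mat n).PosSemidef)
    (hρ : (ρ : Mat n).PosSemidef) (hu : IsUnit ρ) : IsUnit (leftAddRight σ ρ) := by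
  rw [LinearMap.isUnit_iff_ker_eq_bot, LinearMap.ker_eq_bot']
  intro a ha
  have hsum : algTrace A (star a * σ * a) + algTrace A (star (star a) * ρ * star a) = 0 := by
    have hcomm : algTrace A (star (star a) * ρ * star a) = algTrace A (star a * (a * ρ)) := by
      rw [star_star, algTrace_mul_comm]
    rw [hcomm, mul_assoc, ← map_add, ← mul_add, ← leftAddRight_apply, ha, mul_zero, map_zero]
  have hzero := ((add_eq_zero_iff_of_nonneg (posSemidef_star_mul_mul hσ (a : Mat n)).trace_nonneg
    (posSemidef_star_mul_mul hρ (star a : Mat n)).trace_nonneg).1 hsum).2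
  have hmul : ρ * star a = 0 := mul_eq_zero_of_algTrace_conj_eq_zero hρ hzero
  exact star_eq_zero.1 (hu.mul_right_eq_zero.1 hmul)

theorem inverse_leftAddRight_eq {σ ρ x y : A} (hσ : (σ : Mat n).PosSemidef)
    (hρ : (ρ : Mat n).PosSemidef) (hu : IsUnit ρ) (hx : leftAddRight σ ρ x = y) :
    Ring.inverse (leftAddRight σ ρ) y = x := by
  rw [← hx, ← Module.End.mul_apply, Ring.inverse_mul_cancel _ (isUnit_leftAddRight hσ hρ hu),
    Module.End.one_apply]

theorem coe_fDivergence (f : ℝ → ℝ) (σ ρ : A) : (fDivergence f σ ρ : ℂ) =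
    inner ℂ (toHS (pow ρ (1 / 2))) (cfc f (relModular σ ρ) (toHS (pow ρ (1 / 2)))) :=
  (cfc_predicate f (relModular σ ρ) :
    IsSelfAdjoint _).isSymmetric.coe_re_inner_self_apply (toHS (pow ρ (1 / 2)))

theorem fDivergence_exF_eq_algTrace {σ ρ x : A} (hσ : (σ : Mat n).PosSemidef)
    (hρ : (ρ : Mat n).PosSemidef) (hu : IsUnit ρ) (hx : leftAddRight σ ρ x = ρ) :
    (fDivergence exF σ ρ : ℂ) = algTrace A (ρ * x) := by
  obtain ⟨hunit, hcfc⟩ := cfc_exF_relModular hσ hρ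
  have hsolve : (1 + relModular σ ρ) (toHS (x * pow ρ (1 / 2))) = toHS (pow ρ (1 / 2)) := by
    change toHS (x * pow ρ (1 / 2) + σ * (x * pow ρ (1 / 2)) * pow ρ (-1)) = _
    congr 1
    calc x * pow ρ (1 / 2) + σ * (x * pow ρ (1 / 2)) * pow ρ (-1)
        = x * (pow ρ 1 * pow ρ (-(1 / 2))) + σ * x * pow ρ (-(1 / 2)) := by
          rw [← mul_assoc σ, mul_assoc _ _ (pow ρ (-1)), pow_mul_pow hρ hu, pow_mul_pow hρ hu]
          norm_num
      _ = leftAddRight σ ρ x * pow ρ (-(1 / 2)) := by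
          rw [pow_one_eq hρ, leftAddRight_apply, add_mul, ← mul_assoc, add_comm]
      _ = pow ρ 1 * pow ρ (-(1 / 2)) := by rw [hx, pow_one_eq hρ]
      _ = pow ρ (1 / 2) := by
          rw [pow_mul_pow hρ hu]
          norm_num
  have happly : cfc exF (relModular σ ρ) (toHS (pow ρ (1 / 2))) = toHS (x * pow ρ (1 / 2)) := by
    rw [hcfc, ← hsolve, ← mul_apply_eq_comp, Ring.inverse_mul_cancel _ hunit, one_apply_eq_self]
  rw [coe_fDivergence, happly, inner_toHS, star_pow_eq, ← mul_assoc, algTrace_mul_comm,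
    ← mul_assoc, pow_half_mul_pow_half hρ]

theorem fDivergence_exF_eq_algTrace_mul_inverse {σ ρ : A} (hσ : (σ : Mat n).PosSemidef)
    (hρ : (ρ : Mat n).PosSemidef) (hu : IsUnit ρ) :
    (fDivergence exF σ ρ : ℂ) = algTrace A (ρ * Ring.inverse (leftAddRight σ ρ) ρ) := by
  refine fDivergence_exF_eq_algTrace hσ hρ hu ?_
  rw [← Module.End.mul_apply, Ring.mul_inverse_cancel _ (isUnit_leftAddRight hσ hρ hu),
    Module.End.one_apply]

theorem fDivergence_exF_self {ρ : A} (hρ : IsDensity ρ) (hu : IsUnit ρ) :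
    fDivergence exF ρ ρ = 1 / 2 := by
  have hsolve : leftAddRight ρ ρ ((1 / 2 : ℂ) • 1) = ρ := by
    rw [leftAddRight_apply, mul_smul_comm, smul_mul_assoc, mul_one, one_mul, ← add_smul]
    norm_num
  have h := fDivergence_exF_eq_algTrace hρ.pos hρ.pos hu hsolve
  rw [mul_smul_comm, mul_one, map_smul, algTrace_apply, hρ.trace_eq, smul_eq_mul, mul_one] at h
  rw [← Complex.ofReal_inj, h]
  norm_num

/-- If `D v = z v` for `D = T a`, then `T((a - z)* (a - z))` and `T(a* a) - D* D` have the same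
quadratic form at `v`. -/
theorem IsPositiveMap.isUnitalSchwarz {T : A →ₗ[ℂ] B} (hT : IsPositiveMap T) (hunital : T 1 = 1)
    (hcomm : ∀ b c : B, b * c = c * b) : IsUnitalSchwarz T where
  unital := hunital
  schwarz a := by
    have hsa : star (T (star a * a) - star (T a) * T a) = T (star a * a) - star (T a) * T a := by
      rw [star_sub, ← hT.map_star, star_mul, star_mul, star_star, star_star]
    refine posSemidef_of_forall_eigenvector (congrArg Subtype.val hsa)
      (congrArg Subtype.val (hcomm _ (T a))) fun z v hv => ?_
    have hshift : T (star (a - z • 1) * (a - z • 1)) =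
        T (star a * a) - star (T a) * T a + star (T a - z • 1) * (T a - z • 1) := by
      simp only [star_sub, star_smul, star_one, mul_sub, sub_mul, map_sub, hT.map_star, hunital,
        mul_smul_comm, smul_mul_assoc, map_smul, mul_one, one_mul]
      abel
    have hker : (T a - z • 1 : Mat m).mulVec v = 0 := by
      rw [Matrix.sub_mulVec, Matrix.smul_mulVec, Matrix.one_mulVec, hv, sub_self]
    have hpos := (hT _ (posSemidef_star_mul_self (a - z • 1))).dotProduct_mulVec_nonneg v
    have hzero : (star (T a - z • 1 : Mat m) * (T a - z • 1 : Mat m)).mulVec v = 0 := by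
      rw [← Matrix.mulVec_mulVec, hker, Matrix.mulVec_zero]
    rw [hshift] at hpos
    change 0 ≤ star v ⬝ᵥ ((_ + star (T a - z • 1 : Mat m) * (T a - z • 1 : Mat m)).mulVec v) at hpos
    rwa [Matrix.add_mulVec, hzero, add_zero] at hpos

theorem isPositiveMap_mulLeftRight_pow {a : A} (s : ℝ) :
    IsPositiveMap (LinearMap.mulLeftRight ℂ (pow a s, pow a s)) := fun b hb => by
  rw [LinearMap.mulLeftRight_apply]
  nth_rewrite 1 [← star_pow_eq]
  exact posSemidef_star_mul_mul hb _

theorem IsPositiveMap.isUnitalSchwarz_dualMap {T : A →ₗ[ℂ] B} (hT : IsPositiveMap T)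
    (hcomm : ∀ b c : B, b * c = c * b) {ρ : A} (hρ : (ρ : Mat n).PosSemidef) (hu : IsUnit (T ρ)) :
    IsUnitalSchwarz (dualMap T ρ) := by
  refine IsPositiveMap.isUnitalSchwarz (fun a ha => ?_) ?_ hcomm
  · exact isPositiveMap_mulLeftRight_pow _ _ (hT _ (isPositiveMap_mulLeftRight_pow _ a ha))
  · simp only [dualMap, LinearMap.comp_apply, LinearMap.mulLeftRight_apply, mul_one]
    rw [pow_half_mul_pow_half hρ, pow_neg_half_mul_mul_pow_neg_half (hT ρ hρ) hu]

theorem isUnitalSchwarz_starAlgHom (φ : A →⋆ₐ[ℂ] B) :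
    IsUnitalSchwarz φ.toAlgHom.toLinearMap where
  unital := map_one φ
  schwarz a := by
    have : φ (star a * a) - star (φ a) * φ a = 0 := by rw [map_mul, map_star, sub_self]
    change ((φ (star a * a) - star (φ a) * φ a : B) : Mat m).PosSemidef
    rw [this]
    exact Matrix.PosSemidef.zero

end Algebra

section InclusionAdjoint

variable {n : ℕ} {A B : Alg n} {h : B ≤ A}

/-- The inclusion of a subalgebra as a linear map; its Hilbert--Schmidt adjoint is the trace
preserving conditional expectation. -/
abbrev inclusionMap (h : B ≤ A) : B →ₗ[ℂ] A :=
  (StarSubalgebra.inclusion h).toAlgHom.toLinearMap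

theorem algTrace_mul_hsAdjoint_inclusionMap (a : A) (b : B) :
    algTrace B (b * hsAdjoint (inclusionMap h) a) =
      algTrace A (StarSubalgebra.inclusion h b * a) := by
  have hstar : star (inclusionMap h (star b)) = StarSubalgebra.inclusion h b :=
    (map_star (StarSubalgebra.inclusion h) (star b)).symm.trans (congrArg _ (star_star b))
  rw [← hstar, ← algTrace_hsAdjoint, star_star]

theorem isTracePreservingCondExp_hsAdjoint_inclusionMap (h : B ≤ A) :
    IsTracePreservingCondExp h (hsAdjoint (inclusionMap h)) where
  pos := (isUnitalSchwarz_starAlgHom (StarSubalgebra.inclusion h)).isPositiveMap.hsAdjoint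
  bimodule a b c := by
    refine eq_of_algTrace_mul_eq fun d => ?_
    calc algTrace B (d * hsAdjoint (inclusionMap h)
          (StarSubalgebra.inclusion h b * a * StarSubalgebra.inclusion h c))
        = algTrace A (StarSubalgebra.inclusion h (c * (d * b)) * a) := by
          rw [algTrace_mul_hsAdjoint_inclusionMap, ← mul_assoc, algTrace_mul_comm]
          simp only [map_mul, mul_assoc]
      _ = algTrace B (d * (b * hsAdjoint (inclusionMap h) a * c)) := by
          rw [← algTrace_mul_hsAdjoint_inclusionMap, mul_assoc, algTrace_mul_comm]
          simp only [mul_assoc]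
  trace_eq a := by
    have h1 := algTrace_mul_hsAdjoint_inclusionMap (h := h) a 1
    rwa [one_mul, map_one, one_mul] at h1

theorem IsTracePreservingCondExp.algTrace_mul {T : A →ₗ[ℂ] B} (hT : IsTracePreservingCondExp h T)
    (a : A) (b : B) : algTrace B (b * T a) = algTrace A (StarSubalgebra.inclusion h b * a) := by
  have hbimodule := hT.bimodule a b 1
  rw [map_one, mul_one, mul_one] at hbimodule
  rw [← hbimodule]
  exact hT.trace_eq _

theorem IsTracePreservingCondExp.algTrace_map_mul {T : A →ₗ[ℂ] B}
    (hT : IsTracePreservingCondExp h T) (a : A) (b : B) :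
    algTrace B (T a * b) = algTrace A (a * StarSubalgebra.inclusion h b) := by
  rw [algTrace_mul_comm, hT.algTrace_mul, algTrace_mul_comm]

theorem IsTracePreservingCondExp.eq_hsAdjoint {T : A →ₗ[ℂ] B}
    (hT : IsTracePreservingCondExp h T) : T = hsAdjoint (inclusionMap h) :=
  LinearMap.ext fun a => eq_of_algTrace_mul_eq fun b =>
    (hT.algTrace_mul a b).trans (algTrace_mul_hsAdjoint_inclusionMap a b).symm

theorem existsUnique_isTracePreservingCondExp (h : B ≤ A) :
    ∃! T : A →ₗ[ℂ] B, IsTracePreservingCondExp h T :=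
  ⟨_, isTracePreservingCondExp_hsAdjoint_inclusionMap h, fun _ hT => hT.eq_hsAdjoint⟩

theorem IsTracePreservingCondExp.isUnitalSchwarz_hsAdjoint {T : A →ₗ[ℂ] B}
    (hT : IsTracePreservingCondExp h T) : IsUnitalSchwarz (hsAdjoint T) := by
  rw [hT.eq_hsAdjoint, hsAdjoint_hsAdjoint]
  exact isUnitalSchwarz_starAlgHom _

theorem IsTracePreservingCondExp.isDensity_map {T : A →ₗ[ℂ] B}
    (hT : IsTracePreservingCondExp h T) {σ : A} (hσ : IsDensity σ) : IsDensity (T σ) :=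
  ⟨hT.pos σ hσ.pos, (hT.trace_eq σ).trans hσ.trace_eq⟩

theorem IsTracePreservingCondExp.isUnit_map {T : A →ₗ[ℂ] B} (hT : IsTracePreservingCondExp h T)
    {σ : A} (hσ : (σ : Mat n).PosSemidef) (hu : IsUnit σ) : IsUnit (T σ) := by
  have : IsArtinianRing B := IsArtinianRing.of_finite ℂ B
  rw [IsArtinianRing.isUnit_iff_isRightRegular, isRightRegular_iff_left_eq_zero_of_mul]
  intro b hb
  have htrace : algTrace A (star (StarSubalgebra.inclusion h (star b)) * σ *
      StarSubalgebra.inclusion h (star b)) = 0 := by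
    rw [algTrace_mul_comm, ← map_star, star_star, ← mul_assoc, ← map_mul, ← hT.algTrace_mul,
      mul_assoc, hb, mul_zero, map_zero]
  have hzero := hu.mul_right_eq_zero.1 (mul_eq_zero_of_algTrace_conj_eq_zero hσ htrace)
  exact star_eq_zero.1 ((map_eq_zero_iff _ (StarSubalgebra.inclusion_injective h)).1 hzero)

end InclusionAdjoint

section ExX

variable {n : ℕ} {A : Alg n} {σ p : A} {l : ℝ}

theorem exX_eq (p : A) (l : ℝ) : exX p l = (l : ℂ) • 1 + (1 - 2 * l : ℂ) • p := by
  rw [exX]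
  module

theorem exX_mul_one_sub_exX (hp : IsIdempotentElem p) (l : ℝ) :
    exX p l * (1 - exX p l) = (l * (1 - l) : ℂ) • 1 := by
  rw [exX_eq]
  simp only [add_mul, mul_sub, mul_add, smul_mul_assoc, mul_smul_comm, mul_one, one_mul, hp.eq]
  module

theorem coe_mul_one_sub_ne_zero (h0 : l ≠ 0) (h1 : l ≠ 1) : (l * (1 - l) : ℂ) ≠ 0 :=
  mul_ne_zero (Complex.ofReal_ne_zero.2 h0) (sub_ne_zero.2 (Complex.ofReal_ne_one.2 h1).symm)

theorem isUnit_exX_and_isUnit_one_sub_exX (hp : IsIdempotentElem p) (h0 : l ≠ 0) (h1 : l ≠ 1) :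
    IsUnit (exX p l) ∧ IsUnit (1 - exX p l) := by
  have hcomm : Commute (exX p l) (1 - exX p l) := (Commute.one_right _).sub_right (Commute.refl _)
  rw [← hcomm.isUnit_mul_iff, exX_mul_one_sub_exX hp]
  exact isUnit_one.smul (Units.mk0 _ (coe_mul_one_sub_ne_zero h0 h1))

theorem inverse_one_sub_exX (hp : IsIdempotentElem p) (h0 : l ≠ 0) (h1 : l ≠ 1) :
    Ring.inverse (1 - exX p l) = (((l * (1 - l))⁻¹ : ℝ) : ℂ) • exX p l := by
  refine ((isUnit_exX_and_isUnit_one_sub_exX hp h0 h1).2.mul_left_inj).1 ?_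
  rw [Ring.inverse_mul_cancel _ (isUnit_exX_and_isUnit_one_sub_exX hp h0 h1).2, smul_mul_assoc,
    exX_mul_one_sub_exX hp, smul_smul]
  push_cast
  rw [inv_mul_cancel₀ (coe_mul_one_sub_ne_zero h0 h1), one_smul]

theorem exRho_eq (σ : A) (hp : IsIdempotentElem p) (h0 : l ≠ 0) (h1 : l ≠ 1) :
    exRho σ p l = (((l * (1 - l))⁻¹ : ℝ) : ℂ) • (exX p l * σ * exX p l) := by
  rw [exRho, inverse_one_sub_exX hp h0 h1, smul_mul_assoc, smul_mul_assoc]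

theorem leftAddRight_exRho_exX (σ : A) (hp : IsIdempotentElem p) (h0 : l ≠ 0) (h1 : l ≠ 1) :
    leftAddRight σ (exRho σ p l) (exX p l) = exRho σ p l := by
  have h : (1 - exX p l) * exRho σ p l = σ * exX p l := by
    rw [exRho, ← mul_assoc, ← mul_assoc, Ring.mul_inverse_cancel _
      (isUnit_exX_and_isUnit_one_sub_exX hp h0 h1).2, one_mul]
  rw [leftAddRight_apply, ← h, sub_mul, one_mul, sub_add_cancel]

theorem isUnit_exRho (hu : IsUnit σ) (hp : IsIdempotentElem p) (h0 : l ≠ 0) (h1 : l ≠ 1) :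
    IsUnit (exRho σ p l) := by
  obtain ⟨hx, hx'⟩ := isUnit_exX_and_isUnit_one_sub_exX hp h0 h1
  exact (hx'.ringInverse.mul hu).mul hx

theorem star_exX (hp : IsSelfAdjoint p) (l : ℝ) : star (exX p l) = exX p l := by
  simp only [exX, star_add, star_smul, star_sub, star_one, hp.star_eq, Complex.star_def,
    Complex.conj_ofReal]

theorem algTrace_exX_mul_mul_exX (hσ : (σ : Mat n).trace = 1) (hp : IsIdempotentElem p)
    (hl : algTrace A (p * σ) = l) : algTrace A (exX p l * σ * exX p l) = l * (1 - l) := by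
  have hsq : exX p l * exX p l = exX p l - (l * (1 - l) : ℂ) • 1 := by
    rw [← exX_mul_one_sub_exX hp, mul_sub, mul_one, sub_sub_cancel]
  rw [algTrace_mul_comm, ← mul_assoc, hsq, exX_eq]
  simp only [sub_mul, add_mul, smul_mul_assoc, one_mul, map_sub, map_add, map_smul, hl,
    algTrace_apply, hσ, smul_eq_mul]
  ring

theorem IsDensity.exRho (hσ : IsDensity σ) (hp : IsStarProjection p)
    (hl : algTrace A (p * σ) = l) (h0 : 0 < l) (h1 : l < 1) : IsDensity (exRho σ p l) := by
  have hc : (0 : ℝ) ≤ (l * (1 - l))⁻¹ := inv_nonneg.2 (mul_nonneg h0.le (sub_nonneg.2 h1.le))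
  rw [exRho_eq σ hp.isIdempotentElem h0.ne' h1.ne]
  refine ⟨?_, ?_⟩
  · have hpos := posSemidef_star_mul_mul hσ.pos (exX p l : Mat n)
    rw [← StarMemClass.coe_star, star_exX hp.isSelfAdjoint] at hpos
    exact hpos.smul (Complex.zero_le_real.2 hc)
  · rw [← algTrace_apply, map_smul, algTrace_exX_mul_mul_exX hσ.trace_eq hp.isIdempotentElem hl]
    push_cast
    exact inv_mul_cancel₀ (coe_mul_one_sub_ne_zero h0.ne' h1.ne)

theorem inverse_leftAddRight_exRho (hσ : IsDensity σ) (hu : IsUnit σ) (hp : IsStarProjection p)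
    (hl : algTrace A (p * σ) = l) (h0 : 0 < l) (h1 : l < 1) :
    Ring.inverse (leftAddRight σ (exRho σ p l)) (exRho σ p l) = exX p l :=
  inverse_leftAddRight_eq hσ.pos (hσ.exRho hp hl h0 h1).pos
    (isUnit_exRho hu hp.isIdempotentElem h0.ne' h1.ne)
    (leftAddRight_exRho_exX σ hp.isIdempotentElem h0.ne' h1.ne)

theorem algTrace_projection_mul_pos (hσ : (σ : Mat n).PosSemidef) (hu : IsUnit σ)
    (hp : IsStarProjection p) (hne : p ≠ 0) : 0 < algTrace A (p * σ) := by
  have heq : algTrace A (p * σ) = algTrace A (star p * σ * p) := by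
    rw [algTrace_mul_comm (star p * σ), hp.isSelfAdjoint.star_eq, ← mul_assoc,
      hp.isIdempotentElem.eq]
  rw [heq]
  refine lt_of_le_of_ne' (posSemidef_star_mul_mul hσ (p : Mat n)).trace_nonneg fun h => hne ?_
  exact hu.mul_right_eq_zero.1 (mul_eq_zero_of_algTrace_conj_eq_zero hσ h)

theorem algTrace_projection_mul_mem_Ioo (hσ : IsDensity σ) (hu : IsUnit σ)
    (hp : IsStarProjection p) (hne : σ * p ≠ p * σ) (hl : algTrace A (p * σ) = l) :
    l ∈ Set.Ioo 0 1 := by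
  have hp0 : p ≠ 0 := fun h => hne (by rw [h, mul_zero, zero_mul])
  have hp1 : 1 - p ≠ 0 := fun h => hne (by rw [← sub_eq_zero.1 h, mul_one, one_mul])
  have hpos := algTrace_projection_mul_pos hσ.pos hu hp hp0
  have hpos' := algTrace_projection_mul_pos hσ.pos hu hp.one_sub hp1
  rw [sub_mul, one_mul, map_sub, algTrace_apply σ, hσ.trace_eq, hl] at hpos'
  rw [hl] at hpos
  exact ⟨Complex.zero_lt_real.1 hpos, by exact_mod_cast sub_pos.1 hpos'⟩

end ExX

section CondExp

variable {n : ℕ} {A B : Alg n} {h : B ≤ A} {T : A →ₗ[ℂ] B} {σ : A} {q : B} {l : ℝ}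

theorem inclusion_exX (h : B ≤ A) (q : B) (l : ℝ) :
    StarSubalgebra.inclusion h (exX q l) = exX (StarSubalgebra.inclusion h q) l := by
  simp only [exX, map_add, map_smul, map_sub, map_one]

theorem IsTracePreservingCondExp.map_exRho (hT : IsTracePreservingCondExp h T) (σ : A)
    (hq : IsIdempotentElem q) (h0 : l ≠ 0) (h1 : l ≠ 1) :
    T (exRho σ (StarSubalgebra.inclusion h q) l) = exRho (T σ) q l := by
  rw [exRho_eq σ (hq.map (StarSubalgebra.inclusion h)) h0 h1, exRho_eq _ hq h0 h1, map_smul,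
    ← inclusion_exX, hT.bimodule]

theorem IsTracePreservingCondExp.leftAddRight_map_exRho_exX (hT : IsTracePreservingCondExp h T)
    (σ : A) (hq : IsIdempotentElem q) (h0 : l ≠ 0) (h1 : l ≠ 1) :
    leftAddRight (T σ) (T (exRho σ (StarSubalgebra.inclusion h q) l)) (exX q l) =
      T (exRho σ (StarSubalgebra.inclusion h q) l) := by
  rw [hT.map_exRho σ hq h0 h1]
  exact leftAddRight_exRho_exX (T σ) hq h0 h1

theorem IsTracePreservingCondExp.inverse_leftAddRight_map_exRho
    (hT : IsTracePreservingCondExp h T) (hσ : IsDensity σ) (hu : IsUnit σ)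
    (hq : IsStarProjection q) (hl : algTrace A (StarSubalgebra.inclusion h q * σ) = l)
    (h0 : 0 < l) (h1 : l < 1) :
    IsUnit (leftAddRight (T σ) (T (exRho σ (StarSubalgebra.inclusion h q) l))) ∧
      Ring.inverse (leftAddRight (T σ) (T (exRho σ (StarSubalgebra.inclusion h q) l)))
        (T (exRho σ (StarSubalgebra.inclusion h q) l)) = exX q l := by
  have hp := hq.map (StarSubalgebra.inclusion h)
  have hρ := (hσ.exRho hp hl h0 h1).pos
  have hTρu := hT.isUnit_map hρ (isUnit_exRho hu hp.isIdempotentElem h0.ne' h1.ne)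
  exact ⟨isUnit_leftAddRight (hT.pos σ hσ.pos) (hT.pos _ hρ) hTρu,
    inverse_leftAddRight_eq (hT.pos σ hσ.pos) (hT.pos _ hρ) hTρu
      (hT.leftAddRight_map_exRho_exX σ hq.isIdempotentElem h0.ne' h1.ne)⟩

theorem IsTracePreservingCondExp.reversibilitySetting_exRho (hT : IsTracePreservingCondExp h T)
    (hcomm : ∀ b c : B, b * c = c * b) (hσ : IsDensity σ) (hu : IsUnit σ)
    (hq : IsStarProjection q) (hl : algTrace A (StarSubalgebra.inclusion h q * σ) = l)
    (h0 : 0 < l) (h1 : l < 1) :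
    ReversibilitySetting T {σ, exRho σ (StarSubalgebra.inclusion h q) l}
      (exRho σ (StarSubalgebra.inclusion h q) l) := by
  have hp := hq.map (StarSubalgebra.inclusion h)
  have hρ := hσ.exRho hp hl h0 h1
  have hρu := isUnit_exRho hu hp.isIdempotentElem h0.ne' h1.ne
  have hTρu := hT.isUnit_map hρ.pos hρu
  exact
    { density := by rintro τ (rfl | rfl) <;> assumption
      mem := Or.inr rfl
      isUnit := hρu
      isUnit_map := hTρu
      adjoint_schwarz := hT.isUnitalSchwarz_hsAdjoint
      dual_schwarz := IsPositiveMap.isUnitalSchwarz_dualMap hT.pos hcomm hρ.pos hTρu }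

theorem IsTracePreservingCondExp.fDivergence_exF_map_exRho (hT : IsTracePreservingCondExp h T)
    (hσ : IsDensity σ) (hu : IsUnit σ) (hq : IsStarProjection q)
    (hl : algTrace A (StarSubalgebra.inclusion h q * σ) = l) (h0 : 0 < l) (h1 : l < 1) :
    fDivergence exF (T σ) (T (exRho σ (StarSubalgebra.inclusion h q) l)) =
      fDivergence exF σ (exRho σ (StarSubalgebra.inclusion h q) l) := by
  have hp := hq.map (StarSubalgebra.inclusion h)
  have hρ := (hσ.exRho hp hl h0 h1).pos
  have hρu := isUnit_exRho hu hp.isIdempotentElem h0.ne' h1.ne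
  rw [← Complex.ofReal_inj,
    fDivergence_exF_eq_algTrace (hT.pos _ hσ.pos) (hT.pos _ hρ) (hT.isUnit_map hρ hρu)
      (hT.leftAddRight_map_exRho_exX σ hq.isIdempotentElem h0.ne' h1.ne),
    fDivergence_exF_eq_algTrace hσ.pos hρ hρu
      (leftAddRight_exRho_exX σ hp.isIdempotentElem h0.ne' h1.ne),
    hT.algTrace_map_mul, inclusion_exX]

end CondExp

section CrossTerm

variable {n m : ℕ} {A : Alg n} {B : Alg m} {σ p : A} {l : ℝ}

/-- The part of `x σ x`, for `x = (1 - l) p + l (1 - p)`, that detects whether `σ` and `p` commute: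
`x σ x = l² σ + (1 - 2 l) crossTerm σ p l`. -/
def crossTerm (σ p : A) (l : ℝ) : A :=
  (l : ℂ) • (p * σ + σ * p) + (1 - 2 * l : ℂ) • (p * σ * p)

theorem exX_mul_mul_exX (σ p : A) (l : ℝ) :
    exX p l * σ * exX p l = ((l : ℂ) ^ 2) • σ + (1 - 2 * l : ℂ) • crossTerm σ p l := by
  simp only [exX_eq, crossTerm, add_mul, mul_add, smul_mul_assoc, mul_smul_comm, one_mul, mul_one]
  module

theorem posSemidef_crossTerm_of_commute (hσ : (σ : Mat n).PosSemidef) (hp : IsStarProjection p)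
    (hcomm : σ * p = p * σ) (l : ℝ) : (crossTerm σ p l : Mat n).PosSemidef := by
  have heq : crossTerm σ p l = star p * σ * p := by
    rw [crossTerm, hp.isSelfAdjoint.star_eq, mul_assoc p σ p, hcomm, ← mul_assoc,
      hp.isIdempotentElem.eq]
    module
  rw [heq]
  exact posSemidef_star_mul_mul hσ _

-- The corner of `crossTerm σ p l` at `1 - p` vanishes, so positivity kills its off-diagonal part
-- `l p σ (1 - p)`.
theorem commute_of_posSemidef_crossTerm (hσ : star σ = σ) (hp : IsStarProjection p) (hl : l ≠ 0)
    (h : (crossTerm σ p l : Mat n).PosSemidef) : σ * p = p * σ := by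
  have hp_compl : p * (1 - p) = 0 := hp.isIdempotentElem.mul_one_sub_self
  have hright : crossTerm σ p l * (1 - p) = (l : ℂ) • (p * σ * (1 - p)) := by
    simp only [crossTerm, add_mul, smul_mul_assoc, mul_assoc, hp_compl, mul_zero, smul_zero,
      add_zero]
  have hcorner : star (1 - p) * crossTerm σ p l * (1 - p) = 0 := by
    rw [hp.one_sub.isSelfAdjoint.star_eq, mul_assoc, hright, mul_smul_comm, ← mul_assoc,
      ← mul_assoc, hp.isIdempotentElem.one_sub_mul_self, zero_mul, zero_mul, smul_zero]
  have hzero := mul_eq_zero_of_algTrace_conj_eq_zero h (by rw [hcorner, map_zero])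
  rw [hright, smul_eq_zero_iff_right (Complex.ofReal_ne_zero.2 hl), mul_sub, mul_one,
    sub_eq_zero] at hzero
  have hstar := congrArg star hzero
  simp only [star_mul, hσ, hp.isSelfAdjoint.star_eq, ← mul_assoc] at hstar
  exact hstar.trans hzero.symm

theorem map_crossTerm_of_map_exRho {S : B →ₗ[ℂ] A} {τ q : B} (hp : IsIdempotentElem p)
    (hq : IsIdempotentElem q) (h0 : l ≠ 0) (h1 : l ≠ 1) (h2 : l ≠ 1 / 2) (hτ : S τ = σ)
    (hexRho : S (exRho τ q l) = exRho σ p l) : S (crossTerm τ q l) = crossTerm σ p l := by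
  have hc : (((l * (1 - l))⁻¹ : ℝ) : ℂ) ≠ 0 :=
    Complex.ofReal_ne_zero.2 (inv_ne_zero (mul_ne_zero h0 (sub_ne_zero.2 h1.symm)))
  have hc' : (1 - 2 * l : ℂ) ≠ 0 := by
    norm_cast
    exact fun h => h2 (by linarith)
  rw [exRho_eq τ hq h0 h1, exRho_eq σ hp h0 h1, map_smul, smul_right_inj hc, exX_mul_mul_exX,
    exX_mul_mul_exX, map_add, map_smul, map_smul, hτ, add_right_inj, smul_right_inj hc'] at hexRho
  exact hexRho

end CrossTerm

theorem IsTracePreservingCondExp.not_reversible_exRho {n : ℕ} {A B : Alg n} {h : B ≤ A}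
    {T : A →ₗ[ℂ] B} (hT : IsTracePreservingCondExp h T) (hcomm : ∀ b c : B, b * c = c * b)
    {σ : A} {q : B} {l : ℝ} (hσ : (σ : Mat n).PosSemidef) (hq : IsStarProjection q)
    (hne : σ * StarSubalgebra.inclusion h q ≠ StarSubalgebra.inclusion h q * σ)
    (h0 : l ≠ 0) (h1 : l ≠ 1) (h2 : l ≠ 1 / 2) :
    ¬ Reversible T {σ, exRho σ (StarSubalgebra.inclusion h q) l} := by
  rintro ⟨S, hS, hrec⟩
  have hp := hq.map (StarSubalgebra.inclusion h)
  have hS_pos : IsPositiveMap S := hsAdjoint_hsAdjoint S ▸ hS.isPositiveMap.hsAdjoint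
  have hrec_exRho := hrec _ (Or.inr rfl)
  rw [hT.map_exRho σ hq.isIdempotentElem h0 h1] at hrec_exRho
  have hmap := map_crossTerm_of_map_exRho hp.isIdempotentElem hq.isIdempotentElem h0 h1 h2
    (hrec σ (Or.inl rfl)) hrec_exRho
  refine hne (commute_of_posSemidef_crossTerm (star_eq_of_posSemidef hσ) hp h0 ?_)
  rw [← hmap]
  exact hS_pos _ (posSemidef_crossTerm_of_commute (hT.pos σ hσ) hq (hcomm _ _) l)

-- The state is proportional to `1 + v v*` with `v = e_i + 2 e_j`; the more symmetric choice
-- `v = e_i + e_j` would give `Tr p σ = 1 / 2` for two-by-two matrices.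
theorem exists_posDef_not_commute_projection {ι : Type*} [Fintype ι] {i j : ι} (hij : i ≠ j) :
    ∃ s q : Matrix ι ι ℂ, s.PosDef ∧ s.trace = 1 ∧ IsStarProjection q ∧ s * q ≠ q * s ∧
      (q * s).trace = ((2 / (Fintype.card ι + 5) : ℝ) : ℂ) := by
  classical
  let v : ι → ℂ := Pi.single i 1 + Pi.single j 2
  have vi : v i = 1 := by simp [v, hij]
  have vj : v j = 2 := by simp [v, hij.symm]
  have hnorm : v ⬝ᵥ star v = 5 := by
    simp only [v, add_dotProduct, single_dotProduct]
    change 1 * star (v i) + 2 * star (v j) = 5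
    norm_num [vi, vj]
  have hcard : (Fintype.card ι + 5 : ℂ) ≠ 0 := by norm_cast
  have hscale : (0 : ℝ) < (Fintype.card ι + 5 : ℝ)⁻¹ := by positivity
  refine ⟨(Fintype.card ι + 5 : ℝ)⁻¹ • (1 + Matrix.vecMulVec v (star v)), Matrix.single i i 1,
    (Matrix.PosDef.one.add_posSemidef (Matrix.posSemidef_vecMulVec_self_star v)).smul hscale,
    ?_, ⟨?_, ?_⟩, fun hcomm => ?_, ?_⟩
  · rw [Matrix.trace_smul, Matrix.trace_add, Matrix.trace_one, Matrix.trace_vecMulVec, hnorm,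
      Complex.real_smul]
    push_cast
    exact inv_mul_cancel₀ hcard
  · simp [IsIdempotentElem]
  · simp [IsSelfAdjoint, Matrix.star_eq_conjTranspose]
  · have hentry := congrFun (congrFun hcomm j) i
    exact hcard (by simpa [hij.symm, Matrix.vecMulVec_apply, vi, vj] using hentry)
  · simp [Matrix.trace_single_mul, Matrix.vecMulVec_apply, vi]
    ring

theorem exists_density_not_commute_projection {n : ℕ} (hn : 2 ≤ n) :
    ∃ (σ p : (⊤ : Alg n)) (l : ℝ), IsDensity σ ∧ IsUnit σ ∧ IsStarProjection p ∧
      σ * p ≠ p * σ ∧ algTrace ⊤ (p * σ) = (l : ℂ) ∧ l ≠ 1 / 2 := by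
  obtain ⟨s, q, hs, htrace, hq, hne, hqs⟩ := exists_posDef_not_commute_projection
    (i := (⟨0, by lia⟩ : Fin n)) (j := ⟨1, by lia⟩) (by simp)
  let toTop : Mat n →⋆ₐ[ℂ] (⊤ : Alg n) := (StarAlgHom.id ℂ (Mat n)).codRestrict ⊤ fun _ => trivial
  refine ⟨toTop s, toTop q, _, ⟨hs.posSemidef, htrace⟩, hs.isUnit.map toTop, hq.map toTop,
    fun hcomm => hne (congrArg Subtype.val hcomm), hqs, fun h => ?_⟩
  field_simp at h
  linarith [(Nat.cast_nonneg _ : (0 : ℝ) ≤ Fintype.card (Fin n))]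

theorem genBy_mul_comm {n : ℕ} {A : Alg n} {p : A} (hp : IsSelfAdjoint p) (b c : genBy p) :
    b * c = c * b := by
  have : IsStarNormal (p : Mat n) := (hp.map A.subtype).isStarNormal
  exact (StarAlgebra.isMulCommutative_adjoin_singleton ℂ (p : Mat n)).is_comm.comm b c

theorem genBy.isStarProjection_gen {n : ℕ} {A : Alg n} {p : A} (hp : IsStarProjection p) :
    IsStarProjection (genBy.gen p) where
  isIdempotentElem := Subtype.ext (congrArg (fun a : A => (a : Mat n)) hp.isIdempotentElem.eq)
  isSelfAdjoint := Subtype.ext (congrArg (fun a : A => (a : Mat n)) hp.isSelfAdjoint.star_eq)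

theorem exists_fDivergence_exF_preserving_not_reversible {n : ℕ} (hn : 2 ≤ n) :
    ∃ (B : Alg n) (T : (⊤ : Alg n) →ₗ[ℂ] B) (𝒮 : Set (⊤ : Alg n)) (ρ : (⊤ : Alg n)),
      ReversibilitySetting T 𝒮 ρ ∧
      (∀ τ ∈ 𝒮, fDivergence exF (T τ) (T ρ) = fDivergence exF τ ρ) ∧ ¬ Reversible T 𝒮 := by
  obtain ⟨σ, p, l, hσ, hu, hp, hne, hl, h2⟩ := exists_density_not_commute_projection hn
  have hcomm := genBy_mul_comm hp.isSelfAdjoint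
  have hq := genBy.isStarProjection_gen hp
  obtain ⟨h0, h1⟩ := algTrace_projection_mul_mem_Ioo hσ hu hp hne hl
  obtain ⟨T, hT, -⟩ := existsUnique_isTracePreservingCondExp (genBy_le p)
  have hsetting := hT.reversibilitySetting_exRho hcomm hσ hu hq hl h0 h1
  refine ⟨genBy p, T, _, _, hsetting, ?_,
    hT.not_reversible_exRho hcomm hσ.pos hq hne h0.ne' h1.ne h2⟩
  rintro τ (rfl | rfl)
  · exact hT.fDivergence_exF_map_exRho hσ hu hq hl h0 h1
  · have hρ := hsetting.density _ hsetting.mem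
    rw [fDivergence_exF_self hρ hsetting.isUnit,
      fDivergence_exF_self (hT.isDensity_map hρ) hsetting.isUnit_map]

end QRev

theorem mainTheorem10 :
    -- the function and its representing measure
    StrictlyOperatorConvex exF ∧
    (∀ μ : MeasureTheory.Measure ℝ,
      IsRepresentingMeasure exF μ ↔ μ = MeasureTheory.Measure.dirac 1) ∧
    -- the explicit form of the divergence
    (∀ (n : ℕ) (A : Alg n) (σ ρ : A), IsDensity σ → IsDensity ρ → IsUnit ρ →
      IsUnit (leftAddRight σ ρ) ∧
      (fDivergence exF σ ρ : ℂ) =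
        ((ρ * Ring.inverse (leftAddRight σ ρ) ρ : A) : Mat n).trace) ∧
    -- the construction
    (∀ (n : ℕ) (A : Alg n) (σ p : A) (l : ℝ), IsDensity σ → IsUnit σ → IsStarProjection p →
      σ * p ≠ p * σ → ((p * σ : A) : Mat n).trace = (l : ℂ) → l ≠ 1 / 2 →
      (∀ b c : genBy p, b * c = c * b) ∧
      (∃! T : A →ₗ[ℂ] genBy p, IsTracePreservingCondExp (genBy_le p) T) ∧
      ∀ T : A →ₗ[ℂ] genBy p, IsTracePreservingCondExp (genBy_le p) T →
        (∀ b : genBy p, ((T σ * b : genBy p) : Mat n).trace = ((σ : Mat n) * b).trace) ∧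
        0 < l ∧ l < 1 ∧ IsUnit (1 - exX p l) ∧
        exRho σ p l = (((l * (1 - l))⁻¹ : ℝ) : ℂ) • (exX p l * σ * exX p l) ∧
        T (exRho σ p l) =
          Ring.inverse (1 - exX (genBy.gen p) l) * T σ * exX (genBy.gen p) l ∧
        ReversibilitySetting T {σ, exRho σ p l} (exRho σ p l) ∧
        Ring.inverse (leftAddRight σ (exRho σ p l)) (exRho σ p l) = exX p l ∧
        IsUnit (leftAddRight (T σ) (T (exRho σ p l))) ∧
        Ring.inverse (leftAddRight (T σ) (T (exRho σ p l))) (T (exRho σ p l)) =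
          exX (genBy.gen p) l ∧
        fDivergence exF (T σ) (T (exRho σ p l)) = fDivergence exF σ (exRho σ p l) ∧
        ¬ Reversible T {σ, exRho σ p l}) ∧
    -- the construction applies to every noncommutative full matrix algebra
    (∀ n : ℕ, 2 ≤ n → ∃ (σ p : (⊤ : Alg n)) (l : ℝ), IsDensity σ ∧ IsUnit σ ∧
      IsStarProjection p ∧ σ * p ≠ p * σ ∧ ((p * σ : (⊤ : Alg n)) : Mat n).trace = (l : ℂ) ∧
      l ≠ 1 / 2) ∧
    -- preservation of this divergence does not imply reversibility
    ¬ (∀ (n m : ℕ) (A : Alg n) (B : Alg m) (T : A →ₗ[ℂ] B) (𝒮 : Set A) (ρ : A),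
        ReversibilitySetting T 𝒮 ρ →
        (∀ τ ∈ 𝒮, fDivergence exF (T τ) (T ρ) = fDivergence exF τ ρ) → Reversible T 𝒮) := by
  refine ⟨strictlyOperatorConvex_exF, isRepresentingMeasure_exF_iff,
    fun n A σ ρ hσ hρ hu => ⟨isUnit_leftAddRight hσ.pos hρ.pos hu,
      fDivergence_exF_eq_algTrace_mul_inverse hσ.pos hρ.pos hu⟩,
    fun n A σ p l hσ hu hp hne hl h2 => ?construction,
    fun n hn => exists_density_not_commute_projection hn, fun hall => ?_⟩
  case construction =>
    have hcomm := genBy_mul_comm hp.isSelfAdjoint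
    have hq := genBy.isStarProjection_gen hp
    obtain ⟨h0, h1⟩ := algTrace_projection_mul_mem_Ioo hσ hu hp hne hl
    refine ⟨hcomm, existsUnique_isTracePreservingCondExp _, fun T hT => ?_⟩
    have hmap := hT.map_exRho σ hq.isIdempotentElem h0.ne' h1.ne
    have hsetting := hT.reversibilitySetting_exRho hcomm hσ hu hq hl h0 h1
    have hinverse := hT.inverse_leftAddRight_map_exRho hσ hu hq hl h0 h1
    have hpreserved := hT.fDivergence_exF_map_exRho hσ hu hq hl h0 h1
    have hnot := hT.not_reversible_exRho hcomm hσ.pos hq hne h0.ne' h1.ne h2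
    exact ⟨hT.algTrace_map_mul σ, h0, h1,
      (isUnit_exX_and_isUnit_one_sub_exX hp.isIdempotentElem h0.ne' h1.ne).2,
      exRho_eq σ hp.isIdempotentElem h0.ne' h1.ne, hmap, hsetting,
      inverse_leftAddRight_exRho hσ hu hp hl h0 h1, hinverse.1, hinverse.2, hpreserved, hnot⟩
  obtain ⟨B, T, 𝒮, ρ, hsetting, hpreserved, hnot⟩ :=
    exists_fDivergence_exF_preserving_not_reversible le_rfl
  exact hnot (hall _ _ _ B T 𝒮 ρ hsetting hpreserved)
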